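/- Let $E=\mathbb{R}\times\{-1,+1\}$, let $a>0$ and let $\lambda:E\to[0,\infty)$ be continuous; write $\lambda^{\pm}(y)=\lambda(y,\pm1)$. Suppose there are constants $y_0\ge 0$ and $\lambda_{\min}>0$ such that $\lambda(y,j)\ge\lambda_{\min}$ and $\lambda(y,-j)\le\lambda(y,j)$ whenever $jy\ge y_0$. The zig-zag process $(Y,J)$ with speed $a$ and switching rate $\lambda$ started in $(y,j)\in E$ is defined as follows: $T_0=0$, $(Y(0),J(0))=(y,j)$, and for $i\ge1$ the waiting time $Z_i$ has conditional law $\mathbb{P}_{y,j}(Z_i>t\mid Z_1,\dots,Z_{i-1})=F(t;Y(T_{i-1}),J(T_{i-1}))$, $t\ge0$, where $F(t;y,j)=\exp\left(-\int_0^t\lambda(y+ajs,j)\,ds\right)$; $T_i=T_{i-1}+Z_i$; $Y(t)=Y(T_{i-1})+aJ(T_{i-1})(t-T_{i-1})$ for $T_{i-1}<t\le T_i$; $J(t)=J(T_{i-1})$ for $T_{i-1}<t<T_i$, and $J(T_i)=-J(T_{i-1})$. Define $$\Psi(y)=\frac1a\int_0^y\{\lambda^+(\eta)-\lambda^-(\eta)\}\,d\eta,\qquad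 y\in\mathbb{R}.$$ Then $\Psi$ is finite everywhere and bounded from below. Moreover, from every starting point the zig-zag process exists and is almost surely non-explosive ($T_k\to\infty$), its transition probabilities $P_t((y,j),\cdot)=\mathbb{P}_{y,j}((Y(t),J(t))\in\cdot)$ are uniquely determined Markov kernels on $E$, and the measure $\mu$ on $E$ with density $(y,j)\mapsto\exp(-\Psi(y))$ with respect to $\mathrm{Leb}\otimes(\delta_{-1}+\delta_{+1})$ (which may be infinite) is invariant: $\int_E P_t(x,A)\,\mu(dx)=\mu(A)$ for all Borel $A\subseteq E$ and all $t\ge0$. -/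

import Mathlib

open MeasureTheory ProbabilityTheory Filter
open scoped NNReal ENNReal

universe u

namespace ZigZag

/-- The velocity space `{-1, +1}`, realised as the units of `ℤ`, has the discrete σ-algebra. -/
instance instDiscreteMeasurableSpaceSign : DiscreteMeasurableSpace ℤˣ :=
  ⟨fun s => ⟨Units.val '' s, MeasurableSet.of_discrete,
    Set.preimage_image_eq s Units.val_injective⟩⟩

/-- The state space `E = ℝ × {-1, +1}`; a state is a pair (position, direction). -/
abbrev State : Type := ℝ × ℤˣ

noncomputable section

/-- Position at time `s` of a particle that starts in `x.1` and moves with constant velocity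
`a * x.2`. -/
def drift (a : ℝ) (x : State) (s : ℝ) : ℝ := x.1 + a * ((x.2 : ℤ) : ℝ) * s

/-- The survival function `F(t; y, j) = exp (-∫₀ᵗ λ(y + a j s, j) ds)`. -/
def survival (a : ℝ) (lam : State → ℝ) (x : State) (t : ℝ) : ℝ :=
  Real.exp (-∫ s in (0 : ℝ)..t, lam (drift a x s, x.2))

/-- `skeleton a x z k` is the state `(Y(T_k), J(T_k))` immediately after the `k`-th switch, for
the path started in `x` with successive waiting times `z 0, z 1, …`. -/
def skeleton (a : ℝ) (x : State) (z : ℕ → ℝ) : ℕ → State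
  | 0 => x
  | k + 1 => (drift a (skeleton a x z k) (z k), -(skeleton a x z k).2)

/-- The time `T_k` of the `k`-th switch: the sum of the first `k` waiting times; `T_0 = 0`. -/
def switchTime (z : ℕ → ℝ) (k : ℕ) : ℝ := ∑ i ∈ Finset.range k, z i

/-- The number of switches up to time `t`, `N(t) = sup {k | T_k ≤ t}`. -/
def numSwitches (z : ℕ → ℝ) (t : ℝ) : ℕ := sSup {k : ℕ | switchTime z k ≤ t}

/-- The state `(Y(t), J(t))` at time `t` of the path started in `x` with waiting times `z`. -/
def path (a : ℝ) (x : State) (z : ℕ → ℝ) (t : ℝ) : State :=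
  let k := numSwitches z t
  (drift a (skeleton a x z k) (t - switchTime z k), (skeleton a x z k).2)

/-- The random variables `Z 0, Z 1, …` on the probability space `(Ω, Q)` are the successive
waiting times of a zig-zag process with speed `a` and switching rate `lam` started in `x`: given
the previous ones, `Z i` has survival function `F(·; Y(T_i), J(T_i))`. (The numbering starts
at `0`, so `Z i` is the time between the `i`-th and the `(i+1)`-st switch.) The process itself is
`t ↦ path a x (fun k => Z k ω) t`. -/
structure IsZigZag (a : ℝ) (lam : State → ℝ) (x : State) {Ω : Type*} [MeasurableSpace Ω]
    (Q : Measure Ω) (Z : ℕ → Ω → ℝ) : Prop where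
  measurable : ∀ i, Measurable (Z i)
  cond_survival : ∀ (i : ℕ) (t : ℝ), 0 ≤ t →
    Q⟦{ω | t < Z i ω} |
        MeasurableSpace.comap (fun ω (k : Fin i) => Z k ω) MeasurableSpace.pi⟧
      =ᵐ[Q] fun ω => survival a lam (skeleton a x (fun k => Z k ω) i) t

/-- `P` is the transition function of the zig-zag process with speed `a` and rate `lam`: from
every starting point the process exists, and each of its realisations is almost surely
non-explosive and has law `P t x` at time `t`. In particular `P` is unique. -/
structure IsTransitionFunction (a : ℝ) (lam : State → ℝ) (P : ℝ≥0 → Kernel State State) :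
    Prop where
  markov : ∀ t, IsMarkovKernel (P t)
  exists_process : ∀ x : State, ∃ (Ω : Type) (_ : MeasurableSpace Ω) (Q : Measure Ω)
    (Z : ℕ → Ω → ℝ), IsProbabilityMeasure Q ∧ IsZigZag a lam x Q Z
  non_explosive : ∀ (x : State) (Ω : Type u) [MeasurableSpace Ω] (Q : Measure Ω)
    [IsProbabilityMeasure Q] (Z : ℕ → Ω → ℝ), IsZigZag a lam x Q Z →
      ∀ᵐ ω ∂Q, Tendsto (switchTime fun k => Z k ω) atTop atTop
  law : ∀ (x : State) (Ω : Type u) [MeasurableSpace Ω] (Q : Measure Ω)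
    [IsProbabilityMeasure Q] (Z : ℕ → Ω → ℝ), IsZigZag a lam x Q Z →
      ∀ t : ℝ≥0, Q.map (fun ω => path a x (fun k => Z k ω) t) = P t x

/-- There are `y₀ ≥ 0` and `λ_min > 0` such that `λ(y, j) ≥ λ_min` and `λ(y, -j) ≤ λ(y, j)`
whenever `j y ≥ y₀`. -/
def RateAssumption (lam : State → ℝ) : Prop :=
  ∃ y₀ lmin : ℝ, 0 ≤ y₀ ∧ 0 < lmin ∧
    (∀ (y : ℝ) (j : ℤˣ), y₀ ≤ ((j : ℤ) : ℝ) * y → lmin ≤ lam (y, j)) ∧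
    (∀ (y : ℝ) (j : ℤˣ), y₀ ≤ ((j : ℤ) : ℝ) * y → lam (y, -j) ≤ lam (y, j))

/-- `Ψ(y) = (1/a) ∫₀ʸ (λ⁺(η) - λ⁻(η)) dη`. -/
def potential (a : ℝ) (lam : State → ℝ) (y : ℝ) : ℝ :=
  1 / a * ∫ η in (0 : ℝ)..y, (lam (η, 1) - lam (η, -1))

/-- The measure with density `(y, j) ↦ exp (-Ψ(y))` with respect to the product of Lebesgue
measure on `ℝ` and counting measure on `{-1, +1}`. -/
def invMeasure (a : ℝ) (lam : State → ℝ) : Measure State :=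
  ((volume : Measure ℝ).prod (Measure.count : Measure ℤˣ)).withDensity
    fun x => ENNReal.ofReal (Real.exp (-potential a lam x.1))

end

end ZigZag

namespace ZigZag

noncomputable section

variable {a : ℝ} {lam : State → ℝ}

/-! ### The survival function and the law of the waiting times -/

/-! Split the law at time `t` by the number `n` of switches: `P_t f = ∑ₙ Sₙ f`, with `Sₙ` the
operator `switchExp a lam n · t`. Let `R` denote reversal of the direction. Each `Sₙ` is skew
reversible with respect to `μ`: `∫ g · Sₙ f dμ = ∫ (R Sₙ R g) · f dμ` (`lintegral_mul_switchExp`).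
For `n = 0` this says that `exp (-Ψ)` times the probability of no switch is the same for a straight
path and for its reversal (`survival_mul_exp_neg_potential`): the change of `Ψ` along the path is
exactly the difference of the two integrated rates. For larger `n`, reversal turns the first switch
into the last one, so the recursion at the first switch is matched with a decomposition at the last
(`switchExp_succ_last`). With `g = 1`, summation over `n` gives invariance, because `∑ₙ Sₙ 1 = 1`.
All integrands are nonnegative, so Tonelli applies even if `μ` is infinite.

The identity `∑ₙ Sₙ 1 = 1` is non-explosion: bounded speed confines the path up to time `t` to a
compact set, where the rate is bounded, so `E[exp (-T_n); T_n ≤ t]` decays geometrically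
(`IsZigZag.tendsto_switchTime`). The series depends on the realisation only through its starting
point (`IsZigZag.lintegral_path`), whence uniqueness of the law and measurability of the kernel.
Existence is the Ionescu-Tulcea construction (`exists_isZigZag`). -/

lemma continuous_drift : Continuous fun p : State × ℝ => drift a p.1 p.2 := by
  have h : Continuous fun p : State × ℝ => (((p.1.2 : ℤˣ) : ℤ) : ℝ) :=
    (continuous_of_discreteTopology (f := fun j : ℤˣ => ((j : ℤ) : ℝ))).comp
      (continuous_snd.comp continuous_fst)
  unfold drift
  fun_prop

lemma continuous_flow : Continuous fun p : State × ℝ => ((drift a p.1 p.2, p.1.2) : State) :=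
  continuous_drift.prodMk (continuous_snd.comp continuous_fst)

lemma measurable_switch : Measurable fun p : State × ℝ => ((drift a p.1 p.2, -p.1.2) : State) :=
  continuous_drift.measurable.prodMk (measurable_neg.comp (measurable_snd.comp measurable_fst))

lemma continuous_rate_flow (hcont : Continuous lam) :
    Continuous fun p : State × ℝ => lam (drift a p.1 p.2, p.1.2) :=
  hcont.comp continuous_flow

lemma continuous_rate_along (hcont : Continuous lam) (x : State) :
    Continuous fun s : ℝ => lam (drift a x s, x.2) :=
  (continuous_rate_flow hcont).comp (by fun_prop : Continuous fun s : ℝ => (x, s))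

lemma continuous_survival (hcont : Continuous lam) :
    Continuous fun p : State × ℝ => survival a lam p.1 p.2 := by
  unfold survival
  refine Real.continuous_exp.comp (Continuous.neg ?_)
  refine intervalIntegral.continuous_parametric_intervalIntegral_of_continuous
    (f := fun (p : State × ℝ) s => lam (drift a p.1 s, p.1.2)) ?_ continuous_snd
  exact (continuous_rate_flow hcont).comp
    (by fun_prop : Continuous fun q : (State × ℝ) × ℝ => (q.1.1, q.2))

lemma survival_pos (x : State) (t : ℝ) : 0 < survival a lam x t := Real.exp_pos _

lemma survival_zero (x : State) : survival a lam x 0 = 1 := by simp [survival]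

lemma survival_le_one (hnonneg : ∀ x, 0 ≤ lam x) (x : State) {t : ℝ} (ht : 0 ≤ t) :
    survival a lam x t ≤ 1 := by
  refine Real.exp_le_one_iff.2 (neg_nonpos.2 ?_)
  exact intervalIntegral.integral_nonneg ht fun s _ => hnonneg _

lemma hasDerivAt_survival (hcont : Continuous lam) (x : State) (t : ℝ) :
    HasDerivAt (survival a lam x) (-(lam (drift a x t, x.2) * survival a lam x t)) t := by
  have h := (continuous_rate_along (a := a) hcont x).integral_hasStrictDerivAt 0 t
  have := h.hasDerivAt.neg.exp
  refine this.congr_deriv ?_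
  simp only [survival, Pi.neg_apply]; ring

lemma sign_mul_self (j : ℤˣ) : ((j : ℤ) : ℝ) * ((j : ℤ) : ℝ) = 1 := by
  rcases Int.units_eq_one_or j with rfl | rfl <;> simp

lemma abs_sign (j : ℤˣ) : |((j : ℤ) : ℝ)| = 1 := by
  rcases Int.units_eq_one_or j with rfl | rfl <;> simp

lemma tendsto_survival (ha : 0 < a) (hcont : Continuous lam) (hnonneg : ∀ x, 0 ≤ lam x)
    (hlam : RateAssumption lam) (x : State) :
    Tendsto (survival a lam x) atTop (nhds 0) := by
  obtain ⟨y₀, lmin, hy₀, hmin, hlow, -⟩ := hlam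
  refine Real.tendsto_exp_atBot.comp (tendsto_neg_atTop_atBot.comp ?_)
  -- By time `s₀` the particle has passed level `y₀` in its own direction; from then on the rate is
  -- at least `lmin`, so the integrated rate grows at least linearly.
  set s₀ : ℝ := (y₀ + |x.1|) / a with hs₀
  have hs₀n : 0 ≤ s₀ := by positivity
  have hc := continuous_rate_along (a := a) hcont x
  have key : ∀ t, s₀ ≤ t → lmin * (t - s₀) ≤ ∫ s in (0 : ℝ)..t, lam (drift a x s, x.2) := by
    intro t ht
    rw [← intervalIntegral.integral_add_adjacent_intervals (b := s₀)
      (hc.intervalIntegrable _ _) (hc.intervalIntegrable _ _)]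
    have h1 : 0 ≤ ∫ s in (0 : ℝ)..s₀, lam (drift a x s, x.2) :=
      intervalIntegral.integral_nonneg hs₀n fun s _ => hnonneg _
    have h2 : ∫ _ in s₀..t, lmin ≤ ∫ s in s₀..t, lam (drift a x s, x.2) := by
      refine intervalIntegral.integral_mono_on ht (by simp) (hc.intervalIntegrable _ _) ?_
      intro s hs
      refine hlow _ _ ?_
      have e : ((x.2 : ℤ) : ℝ) * drift a x s = ((x.2 : ℤ) : ℝ) * x.1 + a * s := by
        have := sign_mul_self x.2
        unfold drift
        linear_combination (a * s) * this
      have h3 : -|x.1| ≤ ((x.2 : ℤ) : ℝ) * x.1 := by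
        have := neg_abs_le (((x.2 : ℤ) : ℝ) * x.1)
        rwa [abs_mul, abs_sign, one_mul] at this
      have h4 : y₀ + |x.1| ≤ s * a := (div_le_iff₀ ha).1 hs.1
      rw [e]; linarith
    rw [intervalIntegral.integral_const, smul_eq_mul] at h2
    linarith
  refine tendsto_atTop_mono' _ ((eventually_ge_atTop s₀).mono key) ?_
  exact (tendsto_atTop_add_const_right _ (-s₀) tendsto_id).const_mul_atTop hmin

/-- The density of the waiting time until the next switch, for the process in state `x`. -/
def waitDensity (a : ℝ) (lam : State → ℝ) (x : State) (s : ℝ) : ℝ≥0∞ :=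
  if 0 ≤ s then ENNReal.ofReal (lam (drift a x s, x.2) * survival a lam x s) else 0

lemma measurable_waitDensity (hcont : Continuous lam) :
    Measurable (Function.uncurry (waitDensity a lam)) := by
  refine Measurable.ite (measurableSet_le measurable_const measurable_snd) ?_ measurable_const
  exact (((continuous_rate_flow hcont).mul (continuous_survival hcont)).measurable).ennreal_ofReal

/-- The law of the waiting time until the next switch, as a kernel from the current state. -/
def waitKernel (a : ℝ) (lam : State → ℝ) : Kernel State ℝ :=
  (Kernel.const State (volume : Measure ℝ)).withDensity (waitDensity a lam)

lemma waitKernel_apply (hcont : Continuous lam) (x : State) :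
    waitKernel a lam x = (volume : Measure ℝ).withDensity (waitDensity a lam x) := by
  rw [waitKernel, Kernel.withDensity_apply _ (measurable_waitDensity hcont), Kernel.const_apply]

lemma lintegral_waitKernel (hcont : Continuous lam) (x : State) {h : ℝ → ℝ≥0∞}
    (hh : Measurable h) :
    ∫⁻ s, h s ∂(waitKernel a lam x) = ∫⁻ s, waitDensity a lam x s * h s := by
  rw [waitKernel_apply hcont, lintegral_withDensity_eq_lintegral_mul _ _ hh]
  · rfl
  · exact (measurable_waitDensity hcont).comp measurable_prodMk_left

/-- The density is minus the derivative of the survival function, which vanishes at infinity; no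
mass escapes, and a switch happens almost surely. -/
lemma waitKernel_Ioi (ha : 0 < a) (hcont : Continuous lam) (hnonneg : ∀ x, 0 ≤ lam x)
    (hlam : RateAssumption lam) (x : State) {t : ℝ} (ht : 0 ≤ t) :
    waitKernel a lam x (Set.Ioi t) = ENNReal.ofReal (survival a lam x t) := by
  rw [waitKernel_apply hcont, withDensity_apply _ measurableSet_Ioi]
  have e : ∫⁻ s in Set.Ioi t, waitDensity a lam x s
      = ∫⁻ s in Set.Ioi t, ENNReal.ofReal (lam (drift a x s, x.2) * survival a lam x s) :=
    setLIntegral_congr_fun measurableSet_Ioi fun s hs => if_pos (ht.trans (le_of_lt hs))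
  have hd : ∀ s ∈ Set.Ioi t, HasDerivAt (fun r => -survival a lam x r)
      (lam (drift a x s, x.2) * survival a lam x s) s := fun s _ => by
    exact (hasDerivAt_survival hcont x s).neg.congr_deriv (neg_neg _)
  have hn : ∀ s ∈ Set.Ioi t, 0 ≤ lam (drift a x s, x.2) * survival a lam x s :=
    fun s _ => mul_nonneg (hnonneg _) (survival_pos _ _).le
  have hc : ContinuousWithinAt (fun r => -survival a lam x r) (Set.Ici t) t :=
    (hasDerivAt_survival hcont x t).continuousAt.neg.continuousWithinAt
  have hl : Tendsto (fun r => -survival a lam x r) atTop (nhds 0) := by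
    simpa using (tendsto_survival ha hcont hnonneg hlam x).neg
  rw [e, ← ofReal_integral_eq_lintegral_ofReal (integrableOn_Ioi_deriv_of_nonneg hc hd hn hl)
    ((ae_restrict_iff' measurableSet_Ioi).2 (ae_of_all _ hn)),
    integral_Ioi_of_hasDerivAt_of_nonneg hc hd hn hl]
  simp

lemma waitKernel_Iio_zero (hcont : Continuous lam) (x : State) :
    waitKernel a lam x (Set.Iio 0) = 0 := by
  rw [waitKernel_apply hcont, withDensity_apply _ measurableSet_Iio]
  rw [setLIntegral_congr_fun (f := waitDensity a lam x) (g := fun _ => 0) measurableSet_Iio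
    fun s hs => if_neg (not_le.2 hs)]
  simp

lemma waitKernel_Iic_zero (hcont : Continuous lam) (x : State) :
    waitKernel a lam x (Set.Iic 0) = 0 := by
  have h0 : waitKernel a lam x {0} = 0 := by
    rw [waitKernel_apply hcont]
    exact withDensity_absolutelyContinuous _ _ (by simp)
  rw [← Set.Iio_union_right]
  exact measure_union_null (waitKernel_Iio_zero hcont x) h0

lemma isMarkovKernel_waitKernel (ha : 0 < a) (hcont : Continuous lam)
    (hnonneg : ∀ x, 0 ≤ lam x) (hlam : RateAssumption lam) :
    IsMarkovKernel (waitKernel a lam) := by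
  refine ⟨fun x => ⟨?_⟩⟩
  rw [← Set.Iic_union_Ioi (a := (0 : ℝ)), measure_union (Set.Iic_disjoint_Ioi le_rfl)
    measurableSet_Ioi, waitKernel_Iic_zero hcont, waitKernel_Ioi ha hcont hnonneg hlam x le_rfl,
    survival_zero]
  simp

/-! ### The potential -/

lemma continuous_rate_diff (hcont : Continuous lam) :
    Continuous fun η : ℝ => lam (η, 1) - lam (η, -1) :=
  (hcont.comp (by fun_prop)).sub (hcont.comp (by fun_prop))

lemma potential_sub (hcont : Continuous lam) (y z : ℝ) :
    potential a lam z - potential a lam y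
      = 1 / a * ∫ η in y..z, (lam (η, 1) - lam (η, -1)) := by
  have hc := continuous_rate_diff hcont
  unfold potential
  rw [← mul_sub, intervalIntegral.integral_interval_sub_left (hc.intervalIntegrable _ _)
    (hc.intervalIntegrable _ _)]

lemma continuous_potential (hcont : Continuous lam) : Continuous (potential a lam) := by
  refine continuous_const.mul ?_
  exact intervalIntegral.continuous_primitive
    (fun _ _ => (continuous_rate_diff hcont).intervalIntegrable _ _) 0

/-- By the comparison of rates, `Ψ` is nonincreasing left of `-y₀` and nondecreasing right of `y₀`,
so a lower bound on the compact interval between is global. -/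
lemma bddBelow_range_potential (ha : 0 < a) (hcont : Continuous lam)
    (hlam : RateAssumption lam) : BddBelow (Set.range (potential a lam)) := by
  obtain ⟨y₀, lmin, hy₀, -, -, hle⟩ := hlam
  obtain ⟨m, hm⟩ := (isCompact_Icc (a := -y₀) (b := y₀)).bddBelow_image
    (continuous_potential (a := a) hcont).continuousOn
  have hm' : ∀ y ∈ Set.Icc (-y₀) y₀, m ≤ potential a lam y := fun y hy => hm ⟨y, hy, rfl⟩
  have hc := continuous_rate_diff hcont
  refine ⟨m, ?_⟩
  rintro _ ⟨y, rfl⟩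
  rcases lt_or_ge y (-y₀) with h1 | h1
  · have e := potential_sub (a := a) hcont y (-y₀)
    have h2 : ∫ η in y..(-y₀), (lam (η, 1) - lam (η, -1)) ≤ 0 := by
      have := intervalIntegral.integral_mono_on h1.le (hc.intervalIntegrable _ _)
        (intervalIntegrable_const (c := (0 : ℝ)) (μ := volume)) (fun η hη => ?_)
      · simpa using this
      · have hη' : y₀ ≤ (((-1 : ℤˣ) : ℤ) : ℝ) * η := by
          simp only [Units.val_neg, Units.val_one, Int.cast_neg, Int.cast_one]
          linarith [hη.2]
        have := hle η (-1) hη'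
        rw [neg_neg] at this
        linarith
    have h3 := mul_nonpos_of_nonneg_of_nonpos (one_div_pos.2 ha).le h2
    linarith [hm' (-y₀) ⟨le_rfl, by linarith⟩]
  rcases le_or_gt y y₀ with h2 | h2
  · exact hm' y ⟨h1, h2⟩
  · have e := potential_sub (a := a) hcont y₀ y
    have h2 : 0 ≤ ∫ η in y₀..y, (lam (η, 1) - lam (η, -1)) := by
      refine intervalIntegral.integral_nonneg h2.le fun η hη => ?_
      have := hle η 1 (by simpa using hη.1)
      linarith
    have h3 := mul_nonneg (one_div_pos.2 ha).le h2
    linarith [hm' y₀ ⟨by linarith, le_rfl⟩]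

lemma drift_neg_drift (x : State) (t s : ℝ) :
    drift a (drift a x t, -x.2) s = drift a x (t - s) := by
  simp only [drift, Units.val_neg, Int.cast_neg]; ring

/-- Substitute `η = y + a j s`: the Jacobian cancels `1 / a`, and its sign `j` turns `λ⁺ - λ⁻` into
the rate in the direction of motion minus the opposite rate. -/
lemma potential_drift_sub (ha : 0 < a) (hcont : Continuous lam) (x : State) (t : ℝ) :
    potential a lam (drift a x t) - potential a lam x.1
      = ∫ s in (0 : ℝ)..t, (lam (drift a x s, x.2) - lam (drift a x s, -x.2)) := by
  obtain ⟨y, j⟩ := x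
  have hne : a * ((j : ℤ) : ℝ) ≠ 0 := by
    rcases Int.units_eq_one_or j with rfl | rfl <;> simp [ha.ne']
  have h := intervalIntegral.integral_comp_add_mul (a := (0 : ℝ)) (b := t)
    (fun η => lam (η, 1) - lam (η, -1)) hne y
  have hsub := potential_sub (a := a) hcont y (drift a (y, j) t)
  simp only [mul_zero, add_zero] at h
  have hd : ∀ s, y + a * ((j : ℤ) : ℝ) * s = drift a (y, j) s := fun s => rfl
  simp only [hd] at h
  rw [hsub]
  have h' : ∫ η in y..drift a (y, j) t, (lam (η, 1) - lam (η, -1))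
      = a * ((j : ℤ) : ℝ) * ∫ s in (0 : ℝ)..t,
        (lam (drift a (y, j) s, 1) - lam (drift a (y, j) s, -1)) := by
    rw [h, smul_eq_mul, mul_inv_cancel_left₀ hne]
  rw [h']
  rcases Int.units_eq_one_or j with rfl | rfl
  · simp; field_simp
  · simp only [neg_neg]
    rw [← intervalIntegral.integral_const_mul, ← intervalIntegral.integral_const_mul]
    refine intervalIntegral.integral_congr fun s _ => ?_
    simp; field_simp; ring

/-- Skew detailed balance for the deterministic motion between two switches. -/
lemma survival_mul_exp_neg_potential (ha : 0 < a) (hcont : Continuous lam) (x : State) (t : ℝ) :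
    survival a lam x t * Real.exp (-potential a lam x.1)
      = survival a lam (drift a x t, -x.2) t * Real.exp (-potential a lam (drift a x t)) := by
  have hc1 := continuous_rate_along (a := a) hcont x
  have hc2 : Continuous fun s : ℝ => lam (drift a x s, -x.2) :=
    hcont.comp ((continuous_drift.comp
      (by fun_prop : Continuous fun s : ℝ => (x, s))).prodMk continuous_const)
  have h := potential_drift_sub ha hcont x t
  rw [intervalIntegral.integral_sub (hc1.intervalIntegrable _ _)
    (hc2.intervalIntegrable _ _)] at h
  -- The reversed motion visits the same positions in the opposite order, with direction `-x.2`
  -- throughout.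
  have e : ∫ s in (0 : ℝ)..t, lam (drift a (drift a x t, -x.2) s, -x.2)
      = ∫ s in (0 : ℝ)..t, lam (drift a x s, -x.2) := by
    simp only [drift_neg_drift]
    simpa using intervalIntegral.integral_comp_sub_left (a := (0 : ℝ)) (b := t)
      (fun s => lam (drift a x s, -x.2)) t
  unfold survival
  rw [← Real.exp_add, ← Real.exp_add]
  rw [e]
  congr 1
  linarith

/-! ### Expectations on the event of a prescribed number of switches -/

/-- `switchExp a lam n f t x` is the expectation of `f (Y(t), J(t))` on the event that there are
exactly `n` switches up to time `t`, for the process started in `x`; it is `0` if `t < 0`. -/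
def switchExp (a : ℝ) (lam : State → ℝ) : ℕ → (State → ℝ≥0∞) → ℝ → State → ℝ≥0∞
  | 0, f, t, x =>
    if 0 ≤ t then ENNReal.ofReal (survival a lam x t) * f (drift a x t, x.2) else 0
  | n + 1, f, t, x =>
    ∫⁻ s, waitDensity a lam x s * switchExp a lam n f (t - s) (drift a x s, -x.2)

/-- The test function carries a parameter because the decomposition at the last switch integrates
over a variable on which that function depends. -/
lemma measurable_switchExp_param (hcont : Continuous lam) (n : ℕ) {α : Type*}
    [MeasurableSpace α] {h : α × State → ℝ≥0∞} (hh : Measurable h) :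
    Measurable fun q : α × ℝ × State =>
      switchExp a lam n (fun y => h (q.1, y)) q.2.1 q.2.2 := by
  induction n with
  | zero =>
    refine Measurable.ite (measurableSet_le measurable_const (by fun_prop)) ?_ measurable_const
    have hm : Measurable fun q : α × ℝ × State => (q.2.2, q.2.1) := by fun_prop
    refine Measurable.mul ((continuous_survival hcont).measurable.comp hm).ennreal_ofReal ?_
    exact hh.comp (measurable_fst.prodMk (continuous_flow.measurable.comp hm))
  | succ n ih =>
    refine Measurable.lintegral_prod_right' (ν := volume) (f := fun p : (α × ℝ × State) × ℝ =>
      waitDensity a lam p.1.2.2 p.2 * switchExp a lam n (fun y => h (p.1.1, y))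
        (p.1.2.1 - p.2) (drift a p.1.2.2 p.2, -p.1.2.2.2)) ?_
    have hm : Measurable fun p : (α × ℝ × State) × ℝ => (p.1.2.2, p.2) := by fun_prop
    refine Measurable.mul ((measurable_waitDensity hcont).comp hm) ?_
    exact ih.comp (Measurable.prodMk (by fun_prop)
      (Measurable.prodMk (by fun_prop) (measurable_switch.comp hm)))

lemma measurable_switchExp (hcont : Continuous lam) (n : ℕ) {f : State → ℝ≥0∞}
    (hf : Measurable f) :
    Measurable fun q : ℝ × State => switchExp a lam n f q.1 q.2 :=
  (measurable_switchExp_param hcont n (α := Unit) (hf.comp measurable_snd)).comp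
    (measurable_prodMk_left (x := ()))

/-- The switching operator: multiplication by the rate after reversal of the direction. -/
def rateFlip (lam : State → ℝ) (f : State → ℝ≥0∞) (x : State) : ℝ≥0∞ :=
  ENNReal.ofReal (lam x) * f (x.1, -x.2)

lemma measurable_flip : Measurable fun x : State => ((x.1, -x.2) : State) :=
  measurable_fst.prodMk (measurable_neg.comp measurable_snd)

lemma measurable_rateFlip (hcont : Continuous lam) {α : Type*} [MeasurableSpace α]
    {h : α × State → ℝ≥0∞} (hh : Measurable h) :
    Measurable fun p : α × State => rateFlip lam (fun y => h (p.1, y)) p.2 := by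
  unfold rateFlip
  exact Measurable.mul (hcont.measurable.comp measurable_snd).ennreal_ofReal
    (hh.comp (measurable_fst.prodMk (measurable_flip.comp measurable_snd)))

/-- Moving up to a switch, then switching, is a motion without switches tested against `rateFlip`.
In this form the first switch can be treated by the case `n = 0` of skew reversibility. -/
lemma switchExp_zero_rateFlip (hnonneg : ∀ x, 0 ≤ lam x) (f : State → ℝ≥0∞) (s : ℝ)
    (x : State) :
    switchExp a lam 0 (rateFlip lam f) s x = waitDensity a lam x s * f (drift a x s, -x.2) := by
  unfold switchExp waitDensity rateFlip
  split_ifs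
  · rw [ENNReal.ofReal_mul (hnonneg _)]; ring
  · simp

/-- Decomposition at the last switch, where the definition decomposes at the first one. -/
lemma switchExp_succ_last (hcont : Continuous lam) (hnonneg : ∀ x, 0 ≤ lam x) (n : ℕ)
    {f : State → ℝ≥0∞} (hf : Measurable f) (t : ℝ) (x : State) :
    switchExp a lam (n + 1) f t x
      = ∫⁻ s, switchExp a lam n (rateFlip lam (switchExp a lam 0 f s)) (t - s) x := by
  induction n generalizing t x with
  | zero =>
    simp only [switchExp_zero_rateFlip hnonneg]
    -- The recursion integrates over the time of the switch, the claim over the time elapsed since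
    -- it; `s ↦ t - s` exchanges the two.
    rw [← lintegral_sub_left_eq_self _ t]
    simp only [sub_sub_cancel]
    rfl
  | succ n ih =>
    have hm : Measurable fun p : ℝ × State => rateFlip lam (switchExp a lam 0 f p.1) p.2 :=
      measurable_rateFlip hcont (measurable_switchExp hcont 0 hf)
    have hsw : Measurable fun r : ℝ => ((drift a x r, -x.2) : State) :=
      measurable_switch.comp (measurable_prodMk_left (x := x))
    have hwd : Measurable fun r : ℝ => waitDensity a lam x r :=
      (measurable_waitDensity hcont).comp measurable_prodMk_left
    have hmn := measurable_switchExp_param (a := a) hcont n hm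
    calc switchExp a lam (n + 1 + 1) f t x
        = ∫⁻ r, waitDensity a lam x r * ∫⁻ s, switchExp a lam n
            (rateFlip lam (switchExp a lam 0 f s)) (t - r - s) (drift a x r, -x.2) := by
          rw [switchExp]; simp only [ih]
      _ = ∫⁻ r, ∫⁻ s, waitDensity a lam x r * switchExp a lam n
            (rateFlip lam (switchExp a lam 0 f s)) (t - r - s) (drift a x r, -x.2) := by
          refine lintegral_congr fun r => ?_
          rw [lintegral_const_mul]
          exact hmn.comp (Measurable.prodMk measurable_id
            (Measurable.prodMk (by fun_prop) measurable_const))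
      _ = ∫⁻ s, ∫⁻ r, waitDensity a lam x r * switchExp a lam n
            (rateFlip lam (switchExp a lam 0 f s)) (t - r - s) (drift a x r, -x.2) := by
          refine lintegral_lintegral_swap (Measurable.aemeasurable ?_)
          refine Measurable.mul (hwd.comp measurable_fst) ?_
          exact hmn.comp (Measurable.prodMk measurable_snd
            (Measurable.prodMk (by fun_prop) (hsw.comp measurable_fst)))
      _ = _ := by
          refine lintegral_congr fun s => ?_
          rw [switchExp]
          simp only [sub_right_comm]

/-! ### Skew reversibility -/

lemma measurable_density (hcont : Continuous lam) :
    Measurable fun y : ℝ => ENNReal.ofReal (Real.exp (-potential a lam y)) :=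
  (Real.continuous_exp.comp (continuous_potential hcont).neg).measurable.ennreal_ofReal

lemma lintegral_invMeasure (hcont : Continuous lam) {h : State → ℝ≥0∞} (hh : Measurable h) :
    ∫⁻ x, h x ∂(invMeasure a lam)
      = ∑ j : ℤˣ, ∫⁻ y, ENNReal.ofReal (Real.exp (-potential a lam y)) * h (y, j) := by
  have hd : Measurable fun x : State => ENNReal.ofReal (Real.exp (-potential a lam x.1)) :=
    (measurable_density hcont).comp measurable_fst
  rw [invMeasure, lintegral_withDensity_eq_lintegral_mul _ hd hh,
    lintegral_prod_symm _ (hd.mul hh).aemeasurable, lintegral_count, tsum_fintype]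
  rfl

instance sfinite_invMeasure : SFinite (invMeasure a lam) := by
  unfold invMeasure; infer_instance

/-- The density does not depend on the direction. -/
lemma lintegral_invMeasure_flip (hcont : Continuous lam) {h : State → ℝ≥0∞}
    (hh : Measurable h) :
    ∫⁻ x, h (x.1, -x.2) ∂(invMeasure a lam) = ∫⁻ x, h x ∂(invMeasure a lam) := by
  rw [lintegral_invMeasure hcont hh,
    lintegral_invMeasure hcont (h := fun x => h (x.1, -x.2)) (hh.comp measurable_flip)]
  exact Equiv.sum_comp (Equiv.neg ℤˣ)
    (fun j => ∫⁻ y, ENNReal.ofReal (Real.exp (-potential a lam y)) * h (y, j))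

lemma lintegral_mul_switchExp_zero (ha : 0 < a) (hcont : Continuous lam)
    {f g : State → ℝ≥0∞} (hf : Measurable f) (hg : Measurable g) (t : ℝ) :
    ∫⁻ x, g x * switchExp a lam 0 f t x ∂(invMeasure a lam)
      = ∫⁻ x, switchExp a lam 0 (fun z => g (z.1, -z.2)) t (x.1, -x.2) * f x
          ∂(invMeasure a lam) := by
  have h1 : Measurable fun x => switchExp a lam 0 f t x :=
    (measurable_switchExp hcont 0 hf).comp measurable_prodMk_left
  have h2 : Measurable fun x : State =>
      switchExp a lam 0 (fun z => g (z.1, -z.2)) t (x.1, -x.2) :=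
    ((measurable_switchExp hcont 0 (hg.comp measurable_flip)).comp measurable_prodMk_left).comp
      measurable_flip
  rw [lintegral_invMeasure hcont (hg.fun_mul h1), lintegral_invMeasure hcont (h2.fun_mul hf)]
  by_cases ht : 0 ≤ t
  swap
  · simp [switchExp, ht]
  refine Finset.sum_congr rfl fun j _ => ?_
  -- For a fixed direction the motion is a translation, which preserves Lebesgue measure; it remains
  -- to compare the weights at the two ends of the path.
  refine Eq.trans (lintegral_congr fun y => ?_)
    (lintegral_add_right_eq_self _ (a * ((j : ℤ) : ℝ) * t))
  have key := survival_mul_exp_neg_potential ha hcont (y, j) t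
  have hback := drift_neg_drift (a := a) (y, j) t t
  have e : y + a * ((j : ℤ) : ℝ) * t = drift a (y, j) t := rfl
  have e0 : drift a (y, j) (t - t) = y := by simp [drift]
  rw [e]
  simp only [e0] at key hback
  simp only [switchExp, if_pos ht, hback, neg_neg]
  have key' := congrArg ENNReal.ofReal key
  rw [ENNReal.ofReal_mul (survival_pos _ _).le, ENNReal.ofReal_mul (survival_pos _ _).le] at key'
  calc _ = (ENNReal.ofReal (survival a lam (y, j) t)
        * ENNReal.ofReal (Real.exp (-potential a lam y))) * (g (y, j) * f (drift a (y, j) t, j)) := by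
        ring
    _ = _ := by rw [key']; ring

/-- Split the left side at its first switch. Transporting that piece by the case `0` and the rest by
induction makes it the last switch of the reversed path on the right. -/
lemma lintegral_mul_switchExp (ha : 0 < a) (hcont : Continuous lam)
    (hnonneg : ∀ x, 0 ≤ lam x) (n : ℕ)
    {f g : State → ℝ≥0∞} (hf : Measurable f) (hg : Measurable g) (t : ℝ) :
    ∫⁻ x, g x * switchExp a lam n f t x ∂(invMeasure a lam)
      = ∫⁻ x, switchExp a lam n (fun z => g (z.1, -z.2)) t (x.1, -x.2) * f x
          ∂(invMeasure a lam) := by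
  induction n generalizing f g t with
  | zero => exact lintegral_mul_switchExp_zero ha hcont hf hg t
  | succ n ih =>
    set μ := invMeasure a lam
    set Sg : State → ℝ≥0∞ := fun z => g (z.1, -z.2)
    have hSgm : Measurable Sg := hg.comp measurable_flip
    have hmf := measurable_switchExp (a := a) hcont n hf
    have hmf' : ∀ u, Measurable fun x => switchExp a lam n f u x :=
      fun u => hmf.comp measurable_prodMk_left
    have hrf : ∀ {h : State → ℝ≥0∞}, Measurable h → Measurable (rateFlip lam h) := fun hh =>
      hcont.measurable.ennreal_ofReal.mul (hh.comp measurable_flip)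
    have hmg := measurable_switchExp (a := a) hcont 0 hSgm
    have hmg' : ∀ u, Measurable fun x => switchExp a lam 0 Sg u x :=
      fun u => hmg.comp measurable_prodMk_left
    have hrg : Measurable fun p : ℝ × State => rateFlip lam (switchExp a lam 0 Sg p.1) p.2 :=
      measurable_rateFlip hcont hmg
    calc ∫⁻ x, g x * switchExp a lam (n + 1) f t x ∂μ
        = ∫⁻ x, (∫⁻ s, g x * (waitDensity a lam x s *
            switchExp a lam n f (t - s) (drift a x s, -x.2))) ∂μ := by
          refine lintegral_congr fun x => ?_
          rw [switchExp, lintegral_const_mul]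
          refine Measurable.mul ((measurable_waitDensity hcont).comp measurable_prodMk_left) ?_
          exact hmf.comp (Measurable.prodMk (by fun_prop)
            (measurable_switch.comp measurable_prodMk_left))
      _ = ∫⁻ s, ∫⁻ x, g x * (waitDensity a lam x s *
            switchExp a lam n f (t - s) (drift a x s, -x.2)) ∂μ := by
          refine lintegral_lintegral_swap (Measurable.aemeasurable ?_)
          refine (hg.comp measurable_fst).mul ((measurable_waitDensity hcont).mul ?_)
          exact hmf.comp (Measurable.prodMk (by fun_prop) measurable_switch)
      _ = ∫⁻ s, ∫⁻ x, switchExp a lam n (rateFlip lam (switchExp a lam 0 Sg s)) (t - s)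
            (x.1, -x.2) * f x ∂μ := by
          refine lintegral_congr fun s => ?_
          simp only [← switchExp_zero_rateFlip hnonneg]
          rw [lintegral_mul_switchExp_zero ha hcont (hrf (hmf' _)) hg]
          -- The flip brings `switchExp a lam n f` back to the argument `x`; the remaining factor is
          -- the new `g`, whose flip is `rateFlip lam (switchExp a lam 0 Sg s)`.
          rw [← lintegral_invMeasure_flip hcont]
          swap
          · exact ((hmg' s).comp measurable_flip).mul (hrf (hmf' _))
          have hu : Measurable fun x : State =>
              ENNReal.ofReal (lam (x.1, -x.2)) * switchExp a lam 0 Sg s x :=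
            (hcont.measurable.comp measurable_flip).ennreal_ofReal.mul (hmg' s)
          have := ih (f := f) hf hu (t - s)
          simp only [neg_neg] at this
          refine Eq.trans (lintegral_congr fun x => ?_) this
          simp only [rateFlip, neg_neg]
          ring
      _ = ∫⁻ x, (∫⁻ s, switchExp a lam n (rateFlip lam (switchExp a lam 0 Sg s)) (t - s)
            (x.1, -x.2) * f x) ∂μ := by
          refine lintegral_lintegral_swap (Measurable.aemeasurable ?_)
          refine Measurable.mul ?_ (hf.comp measurable_snd)
          exact (measurable_switchExp_param hcont n hrg).comp (Measurable.prodMk measurable_fst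
            (Measurable.prodMk (by fun_prop) (measurable_flip.comp measurable_snd)))
      _ = _ := by
          refine lintegral_congr fun x => ?_
          rw [switchExp_succ_last hcont hnonneg n hSgm, lintegral_mul_const]
          exact (measurable_switchExp_param hcont n hrg).comp (Measurable.prodMk measurable_id
            (Measurable.prodMk (by fun_prop) measurable_const))

/-! ### Realisations of the process -/

lemma measurable_switchTime {Ω : Type*} [MeasurableSpace Ω] {Z : ℕ → Ω → ℝ} {n : ℕ}
    (hZ : ∀ k < n, Measurable (Z k)) : Measurable fun ω => switchTime (fun k => Z k ω) n := by
  unfold switchTime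
  exact Finset.measurable_fun_sum _ fun k hk => hZ k (Finset.mem_range.1 hk)

lemma measurable_skeleton {Ω : Type*} [MeasurableSpace Ω] {Z : ℕ → Ω → ℝ} (x : State) {n : ℕ}
    (hZ : ∀ k < n, Measurable (Z k)) : Measurable fun ω => skeleton a x (fun k => Z k ω) n := by
  induction n with
  | zero => exact measurable_const
  | succ n ih =>
    exact measurable_switch.comp
      ((ih fun k hk => hZ k (hk.trans n.lt_succ_self)).prodMk (hZ n n.lt_succ_self))

/-- The time of the `n`-th switch together with the state right after it. -/
def switchState (a : ℝ) (x : State) {Ω : Type*} (Z : ℕ → Ω → ℝ) (n : ℕ) (ω : Ω) : ℝ × State :=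
  (switchTime (fun k => Z k ω) n, skeleton a x (fun k => Z k ω) n)

lemma measurable_switchState {Ω : Type*} [MeasurableSpace Ω] {Z : ℕ → Ω → ℝ} (x : State) {n : ℕ}
    (hZ : ∀ k < n, Measurable (Z k)) : Measurable (switchState a x Z n) :=
  (measurable_switchTime hZ).prodMk (measurable_skeleton x hZ)

lemma switchTime_succ (z : ℕ → ℝ) (n : ℕ) : switchTime z (n + 1) = switchTime z n + z n :=
  Finset.sum_range_succ _ _

/-- The σ-algebra generated by the first `i` waiting times. -/
abbrev history {Ω : Type*} (Z : ℕ → Ω → ℝ) (i : ℕ) : MeasurableSpace Ω :=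
  MeasurableSpace.comap (fun ω (k : Fin i) => Z k ω) MeasurableSpace.pi

lemma measurable_history {Ω : Type*} (Z : ℕ → Ω → ℝ) {i k : ℕ} (hk : k < i) :
    Measurable[history Z i] (Z k) :=
  (measurable_pi_apply (⟨k, hk⟩ : Fin i)).comp
    (comap_measurable fun ω (k : Fin i) => Z k ω)

/-- The conditional survival property integrated over an event of the past; `switchState` depends
only on the first `i` waiting times, so such an event lies in `history Z i`. -/
lemma IsZigZag.measure_inter_lt {Ω : Type*} [MeasurableSpace Ω]
    {Q : Measure Ω} [IsProbabilityMeasure Q] {Z : ℕ → Ω → ℝ} {x : State}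
    (hnonneg : ∀ x, 0 ≤ lam x) (hZ : IsZigZag a lam x Q Z) (hcont : Continuous lam) (i : ℕ)
    {t : ℝ} (ht : 0 ≤ t) {B : Set (ℝ × State)} (hB : MeasurableSet B) :
    Q (switchState a x Z i ⁻¹' B ∩ {ω | t < Z i ω})
      = ∫⁻ ω in switchState a x Z i ⁻¹' B,
          ENNReal.ofReal (survival a lam (skeleton a x (fun k => Z k ω) i) t) ∂Q := by
  have hm : history Z i ≤ ‹MeasurableSpace Ω› :=
    (measurable_pi_lambda (fun ω (k : Fin i) => Z k ω) fun k => hZ.measurable k).comap_le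
  have hA : MeasurableSet[history Z i] (switchState a x Z i ⁻¹' B) :=
    @measurable_switchState a Ω (history Z i) Z x i (fun k hk => measurable_history Z hk) _ hB
  set A := switchState a x Z i ⁻¹' B
  have hlt : MeasurableSet {ω | t < Z i ω} := measurableSet_lt measurable_const (hZ.measurable i)
  have hsk : Measurable fun ω => survival a lam (skeleton a x (fun k => Z k ω) i) t :=
    (continuous_survival hcont).measurable.comp
      ((measurable_skeleton x fun k _ => hZ.measurable k).prodMk measurable_const)
  have h1 := setIntegral_condExp hm (μ := Q)
    (f := Set.indicator {ω | t < Z i ω} fun _ => (1 : ℝ))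
    ((integrable_const _).indicator hlt) hA
  have h2 : ∫ ω in A, survival a lam (skeleton a x (fun k => Z k ω) i) t ∂Q
      = ∫ ω in A, Set.indicator {ω | t < Z i ω} (fun _ => (1 : ℝ)) ω ∂Q := by
    rw [← h1]
    exact integral_congr_ae (ae_restrict_of_ae (hZ.cond_survival i t ht).symm)
  rw [setIntegral_indicator hlt, setIntegral_const, smul_eq_mul, mul_one] at h2
  rw [← ofReal_integral_eq_lintegral_ofReal, h2, ofReal_measureReal]
  · refine Integrable.of_bound hsk.aestronglyMeasurable 1 (ae_of_all _ fun ω => ?_)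
    rw [Real.norm_of_nonneg (survival_pos _ _).le]
    exact survival_le_one hnonneg _ ht
  · exact ae_of_all _ fun ω => (survival_pos _ _).le

lemma IsZigZag.ae_pos {Ω : Type*} [MeasurableSpace Ω]
    {Q : Measure Ω} [IsProbabilityMeasure Q] {Z : ℕ → Ω → ℝ} {x : State}
    (hnonneg : ∀ x, 0 ≤ lam x) (hZ : IsZigZag a lam x Q Z) (hcont : Continuous lam) :
    ∀ᵐ ω ∂Q, ∀ i, 0 < Z i ω := by
  refine ae_all_iff.2 fun i => ?_
  have h := hZ.measure_inter_lt hnonneg hcont i le_rfl MeasurableSet.univ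
  simp only [Set.preimage_univ, Set.univ_inter, survival_zero, ENNReal.ofReal_one,
    Measure.restrict_univ, lintegral_one, measure_univ] at h
  rw [ae_iff_prob_eq_one (measurable_const.lt (hZ.measurable i))]
  exact h

/-- For fixed `B`, both sides are finite measures in the waiting time with equal total mass, and
they agree on the half-lines, a π-system generating the Borel sets. -/
lemma IsZigZag.map_switchState_prodMk {Ω : Type*} [MeasurableSpace Ω]
    {Q : Measure Ω} [IsProbabilityMeasure Q] {Z : ℕ → Ω → ℝ} {x : State}
    (ha : 0 < a) (hcont : Continuous lam) (hnonneg : ∀ x, 0 ≤ lam x) (hlam : RateAssumption lam)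
    (hZ : IsZigZag a lam x Q Z) (i : ℕ) :
    Q.map (fun ω => (switchState a x Z i ω, Z i ω))
      = (Q.map (switchState a x Z i)) ⊗ₘ ((waitKernel a lam).comap Prod.snd measurable_snd) := by
  have := isMarkovKernel_waitKernel ha hcont hnonneg hlam
  have hW : Measurable (switchState a x Z i) := measurable_switchState x fun k _ => hZ.measurable k
  have hWZ : Measurable fun ω => (switchState a x Z i ω, Z i ω) := hW.prodMk (hZ.measurable i)
  have : IsProbabilityMeasure (Q.map (switchState a x Z i)) :=
    Measure.isProbabilityMeasure_map hW.aemeasurable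
  have : IsProbabilityMeasure (Q.map fun ω => (switchState a x Z i ω, Z i ω)) :=
    Measure.isProbabilityMeasure_map hWZ.aemeasurable
  rw [Measure.ext_prod_iff]
  intro B C hB hC
  set A := switchState a x Z i ⁻¹' B
  have hAm : MeasurableSet A := hW hB
  set κ : Kernel Ω ℝ := (waitKernel a lam).comap (fun ω => skeleton a x (fun k => Z k ω) i)
    (measurable_skeleton x fun k _ => hZ.measurable k) with hκ
  have hpos := hZ.ae_pos hnonneg hcont
  -- Survival is prescribed only for `t ≥ 0`; since waiting times are almost surely positive, a
  -- negative threshold may be replaced by `0`.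
  have hK : ∀ (y : State) (t : ℝ),
      waitKernel a lam y (Set.Ioi t) = ENNReal.ofReal (survival a lam y (max t 0)) := by
    intro y t
    rw [← waitKernel_Ioi ha hcont hnonneg hlam y (le_max_right _ _)]
    refine measure_congr ?_
    have h0 : ∀ᵐ s ∂(waitKernel a lam y), 0 < s := by
      rw [ae_iff]
      simpa [not_lt, Set.Iic_def] using waitKernel_Iic_zero (a := a) hcont y
    filter_upwards [h0] with s hs
    refine propext ?_
    change t < s ↔ max t 0 < s
    simp [hs]
  have hmeas : (Q.restrict A).map (Z i) = (Q.restrict A).bind κ := by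
    have huniv : ((Q.restrict A).map (Z i)) Set.univ = ((Q.restrict A).bind κ) Set.univ := by
      rw [Measure.map_apply (hZ.measurable i) .univ, Measure.bind_apply .univ
        κ.measurable.aemeasurable]
      simp
    refine ext_of_generate_finite (Set.range Set.Ioi)
      ((BorelSpace.measurable_eq (α := ℝ)).trans (borel_eq_generateFrom_Ioi ℝ)) isPiSystem_Ioi
      ?_ huniv
    rintro _ ⟨t, rfl⟩
    rw [Measure.map_apply (hZ.measurable i) measurableSet_Ioi,
      Measure.restrict_apply (hZ.measurable i measurableSet_Ioi),
      Measure.bind_apply measurableSet_Ioi κ.measurable.aemeasurable]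
    simp only [hκ, Kernel.comap_apply, hK]
    rw [← hZ.measure_inter_lt hnonneg hcont i (le_max_right t 0) hB]
    refine measure_congr ?_
    filter_upwards [hpos] with ω hω
    refine propext ?_
    change t < Z i ω ∧ ω ∈ A ↔ ω ∈ A ∧ max t 0 < Z i ω
    simp [hω i, and_comm]
  rw [Measure.map_apply hWZ (hB.prod hC), Measure.compProd_apply_prod hB hC,
    setLIntegral_map hB (Kernel.measurable_coe _ hC) hW]
  have h1 : (Q.restrict A).map (Z i) C = (Q.restrict A).bind κ C := by rw [hmeas]
  rw [Measure.map_apply (hZ.measurable i) hC, Measure.restrict_apply (hZ.measurable i hC),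
    Measure.bind_apply hC κ.measurable.aemeasurable] at h1
  rw [Set.mk_preimage_prod, Set.inter_comm]
  exact h1

/-- The Markov property at the switching times. -/
lemma IsZigZag.lintegral_switchState {Ω : Type*} [MeasurableSpace Ω]
    {Q : Measure Ω} [IsProbabilityMeasure Q] {Z : ℕ → Ω → ℝ} {x : State}
    (ha : 0 < a) (hcont : Continuous lam) (hnonneg : ∀ x, 0 ≤ lam x) (hlam : RateAssumption lam)
    (hZ : IsZigZag a lam x Q Z) (i : ℕ) {H : (ℝ × State) × ℝ → ℝ≥0∞} (hH : Measurable H) :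
    ∫⁻ ω, H (switchState a x Z i ω, Z i ω) ∂Q
      = ∫⁻ ω, ∫⁻ s, H (switchState a x Z i ω, s)
          ∂(waitKernel a lam (switchState a x Z i ω).2) ∂Q := by
  have := isMarkovKernel_waitKernel ha hcont hnonneg hlam
  have hW : Measurable (switchState a x Z i) := measurable_switchState x fun k _ => hZ.measurable k
  have : IsProbabilityMeasure (Q.map (switchState a x Z i)) :=
    Measure.isProbabilityMeasure_map hW.aemeasurable
  rw [← lintegral_map hH (hW.prodMk (hZ.measurable i)),
    hZ.map_switchState_prodMk ha hcont hnonneg hlam, Measure.lintegral_compProd hH,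
    lintegral_map hH.lintegral_kernel_prod_right' hW]
  rfl

/-! ### Non-explosion -/

lemma abs_skeleton_sub_le (ha : 0 < a) {z : ℕ → ℝ} (hz : ∀ k, 0 < z k) (x : State) (n : ℕ) :
    |(skeleton a x z n).1 - x.1| ≤ a * switchTime z n := by
  induction n with
  | zero => simp [skeleton, switchTime]
  | succ n ih =>
    have e : (skeleton a x z (n + 1)).1 - x.1 = ((skeleton a x z n).1 - x.1)
        + a * (((skeleton a x z n).2 : ℤ) : ℝ) * z n := by
      simp only [skeleton, drift]; ring
    rw [e, switchTime_succ, mul_add]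
    refine (abs_add_le _ _).trans (add_le_add ih ?_)
    rw [abs_mul, abs_mul, abs_sign, abs_of_pos ha, abs_of_pos (hz n), mul_one]

/-- During one unit of time the particle stays within `a * (t + 1)` of `x`; take `M` to bound the
continuous rate on that compact set. -/
lemma exists_exp_neg_le_survival (ha : 0 < a) (hcont : Continuous lam) (x : ℝ) (t : ℝ) :
    ∃ M : ℝ, ∀ y : State, |y.1 - x| ≤ a * t → Real.exp (-M) ≤ survival a lam y 1 := by
  obtain ⟨M, hM⟩ := ((isCompact_Icc (a := x - a * (t + 1)) (b := x + a * (t + 1))).prod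
    (isCompact_univ (X := ℤˣ))).bddAbove_image hcont.continuousOn
  refine ⟨M, fun y hy => Real.exp_le_exp.2 (neg_le_neg ?_)⟩
  have h : ∫ s in (0 : ℝ)..1, lam (drift a y s, y.2) ≤ ∫ _ in (0 : ℝ)..1, M := by
    refine intervalIntegral.integral_mono_on zero_le_one
      ((continuous_rate_along hcont y).intervalIntegrable _ _) (by simp) fun s hs => ?_
    refine hM ⟨_, ⟨?_, Set.mem_univ _⟩, rfl⟩
    have h1 : |drift a y s - x| ≤ a * (t + 1) := by
      have e : drift a y s - x = (y.1 - x) + a * ((y.2 : ℤ) : ℝ) * s := by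
        simp only [drift]; ring
      rw [e, mul_add]
      refine (abs_add_le _ _).trans (add_le_add hy ?_)
      rw [abs_mul, abs_mul, abs_sign, abs_of_pos ha, abs_of_nonneg hs.1, mul_one]
      exact mul_le_of_le_one_right ha.le hs.2
    rw [abs_le] at h1
    exact ⟨by linarith [h1.1], by linarith [h1.2]⟩
  refine h.trans ?_
  simp

/-- The function `exp (-u)` cut off after time `t`. -/
def cutExp (t u : ℝ) : ℝ≥0∞ := if u ≤ t then ENNReal.ofReal (Real.exp (-u)) else 0

lemma measurable_cutExp (t : ℝ) : Measurable (cutExp t) :=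
  Measurable.ite measurableSet_Iic (by fun_prop) measurable_const

/-- With probability at least `exp (-M)` the wait exceeds `1` and contributes a factor `exp (-1)`;
otherwise the factor is at most `1`. The cut-off restricts attention to `u ≤ t`, where the bound `M`
is available. -/
lemma lintegral_cutExp_le (ha : 0 < a) (hcont : Continuous lam) (hnonneg : ∀ x, 0 ≤ lam x)
    (hlam : RateAssumption lam) {x t M : ℝ}
    (hM : ∀ y : State, |y.1 - x| ≤ a * t → Real.exp (-M) ≤ survival a lam y 1)
    {y : State} {u : ℝ} (hy : |y.1 - x| ≤ a * u) :
    ∫⁻ s, cutExp t (u + s) ∂(waitKernel a lam y)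
      ≤ ENNReal.ofReal (1 - Real.exp (-M) * (1 - Real.exp (-1))) * cutExp t u := by
  have := isMarkovKernel_waitKernel ha hcont hnonneg hlam
  have h0 : ∀ᵐ s ∂(waitKernel a lam y), 0 < s := by
    rw [ae_iff]
    simpa [not_lt, Set.Iic_def] using waitKernel_Iic_zero (a := a) hcont y
  rcases lt_or_ge t u with htu | htu
  · have : ∫⁻ s, cutExp t (u + s) ∂(waitKernel a lam y) = 0 := by
      refine (lintegral_congr_ae (g := fun _ => 0) ?_).trans lintegral_zero
      filter_upwards [h0] with s hs
      exact if_neg (by linarith)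
    rw [this]; exact zero_le
  set F := survival a lam y 1
  have hF1 : F ≤ 1 := survival_le_one hnonneg y zero_le_one
  have hF0 : 0 < F := survival_pos y 1
  have hFM : Real.exp (-M) ≤ F := hM y (hy.trans (mul_le_mul_of_nonneg_left htu ha.le))
  have he1 : Real.exp (-1) < 1 := Real.exp_lt_one_iff.2 (by norm_num)
  have hKI : waitKernel a lam y (Set.Ioi 1) = ENNReal.ofReal F :=
    waitKernel_Ioi ha hcont hnonneg hlam y zero_le_one
  have hKI' : waitKernel a lam y (Set.Iic 1) = ENNReal.ofReal (1 - F) := by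
    rw [← Set.compl_Ioi, prob_compl_eq_one_sub measurableSet_Ioi, hKI,
      ENNReal.ofReal_sub _ hF0.le, ENNReal.ofReal_one]
  calc ∫⁻ s, cutExp t (u + s) ∂(waitKernel a lam y)
      ≤ ∫⁻ s, (Set.Iic (1 : ℝ)).indicator (fun _ => ENNReal.ofReal (Real.exp (-u))) s
          + (Set.Ioi (1 : ℝ)).indicator
            (fun _ => ENNReal.ofReal (Real.exp (-u) * Real.exp (-1))) s
          ∂(waitKernel a lam y) := by
        refine lintegral_mono_ae ?_
        filter_upwards [h0] with s hs
        have h1 : cutExp t (u + s) ≤ ENNReal.ofReal (Real.exp (-(u + s))) := by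
          unfold cutExp; split_ifs <;> simp
        refine h1.trans ?_
        rcases le_or_gt s 1 with h | h
        · rw [Set.indicator_of_mem (Set.mem_Iic.2 h)]
          refine le_add_right (ENNReal.ofReal_le_ofReal (Real.exp_le_exp.2 (by linarith)))
        · rw [Set.indicator_of_mem (Set.mem_Ioi.2 h), ← Real.exp_add]
          refine le_add_left (ENNReal.ofReal_le_ofReal (Real.exp_le_exp.2 (by linarith)))
    _ = ENNReal.ofReal (Real.exp (-u)) * ENNReal.ofReal (1 - F)
          + ENNReal.ofReal (Real.exp (-u) * Real.exp (-1)) * ENNReal.ofReal F := by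
        rw [lintegral_add_left (measurable_const.indicator measurableSet_Iic),
          lintegral_indicator_const measurableSet_Iic,
          lintegral_indicator_const measurableSet_Ioi, hKI, hKI']
    _ = ENNReal.ofReal ((1 - F * (1 - Real.exp (-1))) * Real.exp (-u)) := by
        rw [← ENNReal.ofReal_mul (by positivity), ← ENNReal.ofReal_mul (by positivity),
          ← ENNReal.ofReal_add (mul_nonneg (by positivity) (by linarith)) (by positivity)]
        congr 1; ring
    _ ≤ ENNReal.ofReal ((1 - Real.exp (-M) * (1 - Real.exp (-1))) * Real.exp (-u)) := by
        refine ENNReal.ofReal_le_ofReal (mul_le_mul_of_nonneg_right ?_ (by positivity))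
        have := mul_le_mul_of_nonneg_right hFM (by linarith : 0 ≤ 1 - Real.exp (-1))
        linarith
    _ = _ := by
        rw [cutExp, if_pos htu, ENNReal.ofReal_mul' (by positivity)]

lemma IsZigZag.tendsto_switchTime {Ω : Type*} [MeasurableSpace Ω]
    {Q : Measure Ω} [IsProbabilityMeasure Q] {Z : ℕ → Ω → ℝ} {x : State}
    (ha : 0 < a) (hcont : Continuous lam) (hnonneg : ∀ x, 0 ≤ lam x) (hlam : RateAssumption lam)
    (hZ : IsZigZag a lam x Q Z) :
    ∀ᵐ ω ∂Q, Tendsto (switchTime fun k => Z k ω) atTop atTop := by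
  have hpos := hZ.ae_pos hnonneg hcont
  have key : ∀ t : ℝ, ∀ᵐ ω ∂Q, ∃ n, t < switchTime (fun k => Z k ω) n := by
    intro t
    obtain ⟨M, hM⟩ := exists_exp_neg_le_survival ha hcont x.1 t
    set c : ℝ≥0∞ := ENNReal.ofReal (1 - Real.exp (-M) * (1 - Real.exp (-1))) with hc
    have hc1 : c < 1 := by
      rw [hc, ← ENNReal.ofReal_one, ENNReal.ofReal_lt_ofReal_iff one_pos]
      have he1 : Real.exp (-1) < 1 := Real.exp_lt_one_iff.2 (by norm_num)
      have := mul_pos (Real.exp_pos (-M)) (by linarith : 0 < 1 - Real.exp (-1))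
      linarith
    have hn : ∀ n, ∫⁻ ω, cutExp t (switchTime (fun k => Z k ω) n) ∂Q ≤ c ^ n := by
      intro n
      induction n with
      | zero =>
        rw [pow_zero, ← measure_univ (μ := Q), ← lintegral_one]
        refine lintegral_mono fun ω => ?_
        rw [show switchTime (fun k => Z k ω) 0 = 0 from rfl, cutExp]
        split_ifs <;> simp
      | succ n ih =>
        have h1 := hZ.lintegral_switchState ha hcont hnonneg hlam n
          (H := fun p => cutExp t (p.1.1 + p.2)) ((measurable_cutExp t).comp (by fun_prop))
        simp only [switchState, ← switchTime_succ] at h1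
        rw [h1, pow_succ']
        refine le_trans ?_ (mul_le_mul_right ih c)
        rw [← lintegral_const_mul (f := fun ω => cutExp t (switchTime (fun k => Z k ω) n)) c
          ((measurable_cutExp t).comp (measurable_switchTime fun k _ => hZ.measurable k))]
        refine lintegral_mono_ae ?_
        filter_upwards [hpos] with ω hω
        exact lintegral_cutExp_le ha hcont hnonneg hlam hM (abs_skeleton_sub_le ha hω x n)
    -- Markov's inequality: if all switches occur by time `t`, then `cutExp t` of each switch time
    -- is at least `exp (-t)`.
    have hle : ∀ n, ENNReal.ofReal (Real.exp (-t)) *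
        Q {ω | ∀ n, switchTime (fun k => Z k ω) n ≤ t} ≤ c ^ n := by
      intro n
      refine le_trans ?_ (hn n)
      have hms : MeasurableSet {ω | switchTime (fun k => Z k ω) n ≤ t} :=
        measurableSet_le (measurable_switchTime fun k _ => hZ.measurable k) measurable_const
      have hsub : {ω | ∀ n, switchTime (fun k => Z k ω) n ≤ t}
          ⊆ {ω | switchTime (fun k => Z k ω) n ≤ t} := fun ω hω => hω n
      refine (mul_le_mul_right (measure_mono hsub) _).trans ?_
      rw [← lintegral_indicator_const hms]
      refine lintegral_mono fun ω => ?_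
      refine Set.indicator_le (g := fun ω => cutExp t (switchTime (fun k => Z k ω) n))
        (fun ω hω => ?_) ω
      have hω' : switchTime (fun k => Z k ω) n ≤ t := hω
      simp only [cutExp, if_pos hω']
      exact ENNReal.ofReal_le_ofReal (Real.exp_le_exp.2 (by linarith))
    have h0 := ge_of_tendsto' (ENNReal.tendsto_pow_atTop_nhds_zero_of_lt_one hc1) hle
    have h0' : Q {ω | ∀ n, switchTime (fun k => Z k ω) n ≤ t} = 0 := by
      rcases mul_eq_zero.1 (le_antisymm h0 zero_le) with h | h
      · exact absurd h (ENNReal.ofReal_pos.2 (Real.exp_pos _)).ne'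
      · exact h
    rw [ae_iff]
    simpa only [not_exists, not_lt] using h0'
  filter_upwards [hpos, ae_all_iff.2 fun N : ℕ => key N] with ω hω hN
  refine tendsto_atTop_atTop_of_monotone ?_ fun b => ?_
  · exact monotone_nat_of_le_succ fun n => by rw [switchTime_succ]; linarith [hω n]
  · obtain ⟨N, hN'⟩ := exists_nat_ge b
    obtain ⟨n, hn⟩ := hN N
    exact ⟨n, hN'.trans hn.le⟩

/-! ### The law at a fixed time -/

lemma numSwitches_eq {z : ℕ → ℝ} (hz : ∀ k, 0 < z k) {t : ℝ} {n : ℕ}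
    (h1 : switchTime z n ≤ t) (h2 : t < switchTime z (n + 1)) : numSwitches z t = n := by
  have hmono : Monotone (switchTime z) :=
    monotone_nat_of_le_succ fun n => by rw [switchTime_succ]; linarith [hz n]
  refine IsGreatest.csSup_eq ⟨h1, fun k hk => ?_⟩
  by_contra h
  exact absurd ((hmono (not_le.1 h)).trans hk) (not_le.2 h2)

lemma exists_switchTime_le_lt {z : ℕ → ℝ} (hz : Tendsto (switchTime z) atTop atTop) {t : ℝ}
    (ht : 0 ≤ t) : ∃ n, switchTime z n ≤ t ∧ t < switchTime z (n + 1) := by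
  classical
  have hex : ∃ n, t < switchTime z n := (hz.eventually_gt_atTop t).exists
  have h0 : Nat.find hex ≠ 0 := fun h => by
    have := Nat.find_spec hex
    rw [h] at this
    simp only [switchTime, Finset.range_zero, Finset.sum_empty] at this
    linarith
  obtain ⟨n, hn⟩ := Nat.exists_eq_succ_of_ne_zero h0
  refine ⟨n, not_lt.1 (Nat.find_min hex (by omega)), ?_⟩
  have := Nat.find_spec hex
  rwa [hn] at this

lemma path_eq {z : ℕ → ℝ} (hz : ∀ k, 0 < z k) (x : State) {t : ℝ} {n : ℕ}
    (h1 : switchTime z n ≤ t) (h2 : t < switchTime z (n + 1)) :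
    path a x z t = (drift a (skeleton a x z n) (t - switchTime z n), (skeleton a x z n).2) := by
  simp only [path, numSwitches_eq hz h1 h2]

lemma measurable_flow_switchState {Ω : Type*} [MeasurableSpace Ω] {Z : ℕ → Ω → ℝ} (x : State)
    (hZ : ∀ k, Measurable (Z k)) (t : ℝ) (n : ℕ) :
    Measurable fun ω => ((drift a (skeleton a x (fun k => Z k ω) n)
      (t - switchTime (fun k => Z k ω) n), (skeleton a x (fun k => Z k ω) n).2) : State) :=
  continuous_flow.measurable.comp ((measurable_skeleton x fun k _ => hZ k).prodMk
    (measurable_const.sub (measurable_switchTime fun k _ => hZ k)))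

/-- On the event of exactly `n` switches the path agrees almost surely with a measurable function,
and by non-explosion these events cover almost everything. -/
lemma IsZigZag.aemeasurable_path {Ω : Type*} [MeasurableSpace Ω]
    {Q : Measure Ω} [IsProbabilityMeasure Q] {Z : ℕ → Ω → ℝ} {x : State}
    (ha : 0 < a) (hcont : Continuous lam) (hnonneg : ∀ x, 0 ≤ lam x) (hlam : RateAssumption lam)
    (hZ : IsZigZag a lam x Q Z) {t : ℝ} (ht : 0 ≤ t) :
    AEMeasurable (fun ω => path a x (fun k => Z k ω) t) Q := by
  have hpos := hZ.ae_pos hnonneg hcont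
  set A : ℕ → Set Ω := fun n => {ω | switchTime (fun k => Z k ω) n ≤ t ∧
    t < switchTime (fun k => Z k ω) (n + 1)}
  have hAm : ∀ n, MeasurableSet (A n) := fun n =>
    (measurableSet_le (measurable_switchTime fun k _ => hZ.measurable k) measurable_const).inter
      (measurableSet_lt measurable_const (measurable_switchTime fun k _ => hZ.measurable k))
  have hU : Q.restrict (⋃ n, A n) = Q := by
    refine Measure.restrict_eq_self_of_ae_mem ?_
    filter_upwards [hZ.tendsto_switchTime ha hcont hnonneg hlam] with ω hω
    exact Set.mem_iUnion.2 (exists_switchTime_le_lt hω ht)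
  rw [← hU, aemeasurable_iUnion_iff]
  intro n
  refine ⟨_, measurable_flow_switchState (a := a) x hZ.measurable t n, ?_⟩
  rw [Filter.EventuallyEq, ae_restrict_iff' (hAm n)]
  filter_upwards [hpos] with ω hω hn
  exact path_eq hω x hn.1 hn.2

/-- Each induction step uses the Markov property at a switching time to trade one realised switch
for one level of the recursion. -/
lemma IsZigZag.lintegral_switchExp {Ω : Type*} [MeasurableSpace Ω]
    {Q : Measure Ω} [IsProbabilityMeasure Q] {Z : ℕ → Ω → ℝ} {x : State}
    (ha : 0 < a) (hcont : Continuous lam) (hnonneg : ∀ x, 0 ≤ lam x) (hlam : RateAssumption lam)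
    (hZ : IsZigZag a lam x Q Z) {f : State → ℝ≥0∞} (hf : Measurable f) (t : ℝ) (n m : ℕ) :
    ∫⁻ ω, switchExp a lam m f (t - switchTime (fun k => Z k ω) n)
      (skeleton a x (fun k => Z k ω) n) ∂Q = switchExp a lam (n + m) f t x := by
  induction n generalizing m with
  | zero => simp [switchTime, skeleton]
  | succ n ih =>
    have hm := measurable_switchExp (a := a) hcont m hf
    have h1 := hZ.lintegral_switchState ha hcont hnonneg hlam n
      (H := fun p => switchExp a lam m f (t - p.1.1 - p.2) (drift a p.1.2 p.2, -p.1.2.2))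
      (hm.comp (Measurable.prodMk (by fun_prop) (measurable_switch.comp
        (by fun_prop : Measurable fun p : (ℝ × State) × ℝ => (p.1.2, p.2)))))
    simp only [switchTime_succ, ← sub_sub]
    refine h1.trans ?_
    rw [add_right_comm, add_assoc, ← ih (m + 1)]
    refine lintegral_congr fun ω => ?_
    rw [lintegral_waitKernel hcont]
    · rfl
    · exact hm.comp (Measurable.prodMk (by fun_prop)
        (measurable_switch.comp measurable_prodMk_left))

lemma IsZigZag.lintegral_path {Ω : Type*} [MeasurableSpace Ω]
    {Q : Measure Ω} [IsProbabilityMeasure Q] {Z : ℕ → Ω → ℝ} {x : State}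
    (ha : 0 < a) (hcont : Continuous lam) (hnonneg : ∀ x, 0 ≤ lam x) (hlam : RateAssumption lam)
    (hZ : IsZigZag a lam x Q Z) {f : State → ℝ≥0∞} (hf : Measurable f) {t : ℝ} (ht : 0 ≤ t) :
    ∫⁻ ω, f (path a x (fun k => Z k ω) t) ∂Q = ∑' n, switchExp a lam n f t x := by
  -- At `(T_n, state, Z_n)`, `H` is the value at time `t` on the event `T_n ≤ t < T_{n+1}`. Almost
  -- surely exactly one `n` satisfies this, and integrating out `Z_n` yields `switchExp a lam 0`.
  set H : (ℝ × State) × ℝ → ℝ≥0∞ := fun p =>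
    {p : (ℝ × State) × ℝ | p.1.1 ≤ t ∧ t - p.1.1 < p.2}.indicator
      (fun p => f (drift a p.1.2 (t - p.1.1), p.1.2.2)) p with hH
  have hHm : Measurable H := by
    refine Measurable.indicator (hf.comp (continuous_flow.measurable.comp
      (by fun_prop : Measurable fun p : (ℝ × State) × ℝ => (p.1.2, t - p.1.1)))) ?_
    exact (measurableSet_le (measurable_fst.comp measurable_fst) measurable_const).inter
      (measurableSet_lt (measurable_const.sub (measurable_fst.comp measurable_fst)) measurable_snd)
  have h1 : ∀ᵐ ω ∂Q, f (path a x (fun k => Z k ω) t)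
      = ∑' n, H (switchState a x Z n ω, Z n ω) := by
    filter_upwards [hZ.ae_pos hnonneg hcont, hZ.tendsto_switchTime ha hcont hnonneg hlam]
      with ω hω hω'
    obtain ⟨n, hn, hn'⟩ := exists_switchTime_le_lt hω' ht
    rw [tsum_eq_single n, path_eq hω x hn hn']
    · have hn'' := hn'
      rw [switchTime_succ] at hn''
      rw [hH]
      simp only
      rw [Set.indicator_of_mem]
      · rfl
      · exact ⟨hn, by simp only [switchState]; linarith⟩
    · intro m hmn
      refine Set.indicator_of_notMem (fun hm => hmn ?_) _
      have hm2 : t < switchTime (fun k => Z k ω) (m + 1) := by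
        rw [switchTime_succ]
        have := hm.2
        simp only [switchState] at this
        linarith
      rw [← numSwitches_eq hω hm.1 hm2, numSwitches_eq hω hn hn']
  rw [lintegral_congr_ae h1, lintegral_tsum
    (f := fun n ω => H (switchState a x Z n ω, Z n ω)) fun n => (hHm.comp ((measurable_switchState x
    fun k _ => hZ.measurable k).prodMk (hZ.measurable n))).aemeasurable]
  refine tsum_congr fun n => ?_
  rw [hZ.lintegral_switchState ha hcont hnonneg hlam n hHm]
  refine Eq.trans (lintegral_congr fun ω => ?_)
    (hZ.lintegral_switchExp ha hcont hnonneg hlam hf t n 0)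
  set T := switchTime (fun k => Z k ω) n
  set y := skeleton a x (fun k => Z k ω) n
  change ∫⁻ s, H ((T, y), s) ∂(waitKernel a lam y) = _
  rw [switchExp]
  by_cases hT : T ≤ t
  · rw [if_pos (sub_nonneg.2 hT), ← waitKernel_Ioi ha hcont hnonneg hlam y (sub_nonneg.2 hT),
      mul_comm, ← lintegral_indicator_const measurableSet_Ioi]
    refine lintegral_congr fun s => ?_
    simp only [hH, Set.indicator, Set.mem_ofPred_eq, hT, true_and, Set.mem_Ioi]
  · rw [if_neg (by simpa using hT)]
    simp [hH, Set.indicator, hT]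

/-! ### Existence -/

lemma skeleton_congr (x : State) {z z' : ℕ → ℝ} {n : ℕ} (h : ∀ k < n, z k = z' k) :
    skeleton a x z n = skeleton a x z' n := by
  induction n with
  | zero => rfl
  | succ n ih =>
    simp only [skeleton, ih fun k hk => h k (hk.trans n.lt_succ_self), h n n.lt_succ_self]

/-- The waiting times recorded in a finite sequence whose entry with index `0` is a dummy. -/
def pastWait (n : ℕ) (k : ℕ) (h : (i : Finset.Iic n) → (fun _ : ℕ => ℝ) i) : ℝ :=
  if hk : k + 1 ≤ n then h ⟨k + 1, Finset.mem_Iic.2 hk⟩ else 0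

lemma measurable_pastWait (n k : ℕ) : Measurable (pastWait n k) := by
  unfold pastWait
  split_ifs with hk
  · exact measurable_pi_apply _
  · exact measurable_const

/-- The conditional law of a waiting time given the preceding ones. -/
def stepKernel (a : ℝ) (lam : State → ℝ) (x : State) (n : ℕ) :
    Kernel ((i : Finset.Iic n) → (fun _ : ℕ => ℝ) i) ((fun _ : ℕ => ℝ) (n + 1)) :=
  (waitKernel a lam).comap (fun h => skeleton a x (fun k => pastWait n k h) n)
    (measurable_skeleton x fun k _ => measurable_pastWait n k)

lemma stepKernel_frestrictLe_Ioi (ha : 0 < a) (hcont : Continuous lam)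
    (hnonneg : ∀ x, 0 ≤ lam x) (hlam : RateAssumption lam) (x : State) (i : ℕ) (ω : ℕ → ℝ)
    {t : ℝ} (ht : 0 ≤ t) :
    stepKernel a lam x i (Preorder.frestrictLe i ω) (Set.Ioi t)
      = ENNReal.ofReal (survival a lam (skeleton a x (fun k => ω (k + 1)) i) t) := by
  have hsk : skeleton a x (fun k => pastWait i k (Preorder.frestrictLe i ω)) i
      = skeleton a x (fun k => ω (k + 1)) i :=
    skeleton_congr x fun k hk => by
      simp only [pastWait, dif_pos (show k + 1 ≤ i from hk)]
      rfl
  rw [← hsk]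
  exact waitKernel_Ioi ha hcont hnonneg hlam _ ht

lemma isMarkovKernel_stepKernel (ha : 0 < a) (hcont : Continuous lam)
    (hnonneg : ∀ x, 0 ≤ lam x) (hlam : RateAssumption lam) (x : State) (n : ℕ) :
    IsMarkovKernel (stepKernel a lam x n) := by
  have := isMarkovKernel_waitKernel ha hcont hnonneg hlam
  unfold stepKernel
  infer_instance

lemma condExp_traj_stepKernel (ha : 0 < a) (hcont : Continuous lam)
    (hnonneg : ∀ x, 0 ≤ lam x) (hlam : RateAssumption lam) (x : State)
    [∀ n, IsMarkovKernel (stepKernel a lam x n)] (i : ℕ) {t : ℝ} (ht : 0 ≤ t)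
    {Q : Measure (ℕ → ℝ)} {x₀ : (i : Finset.Iic 0) → (fun _ : ℕ => ℝ) i}
    (hQ : Q = Kernel.traj (stepKernel a lam x) 0 x₀) :
    Q[Set.indicator {ω | t < ω (i + 1)} fun _ => (1 : ℝ) |
      (Filtration.piLE (X := fun _ : ℕ => ℝ) i : MeasurableSpace (ℕ → ℝ))]
      =ᵐ[Q] fun ω => survival a lam (skeleton a x (fun k => ω (k + 1)) i) t := by
  subst hQ
  have hlt : MeasurableSet {ω : ℕ → ℝ | t < ω (i + 1)} :=
    measurableSet_lt measurable_const (measurable_pi_apply (i + 1))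
  have hint : Integrable (Set.indicator {ω : ℕ → ℝ | t < ω (i + 1)} fun _ => (1 : ℝ))
      (Kernel.traj (stepKernel a lam x) 0 x₀) := (integrable_const _).indicator hlt
  refine (Kernel.condExp_traj (Nat.zero_le i) hint).trans (ae_of_all _ fun ω => ?_)
  have hmap : ((Kernel.traj (stepKernel a lam x) i).map fun ω => ω (i + 1))
      (Preorder.frestrictLe i ω) (Set.Ioi t)
        = stepKernel a lam x i (Preorder.frestrictLe i ω) (Set.Ioi t) := by
    rw [Kernel.map_traj_succ_self]
  rw [Kernel.map_apply' _ (measurable_pi_apply (i + 1)) _ measurableSet_Ioi,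
    stepKernel_frestrictLe_Ioi ha hcont hnonneg hlam x i ω ht] at hmap
  beta_reduce
  rw [integral_indicator hlt, setIntegral_const, smul_eq_mul, mul_one]
  exact (congrArg ENNReal.toReal hmap).trans (ENNReal.toReal_ofReal (survival_pos _ _).le)

lemma exists_isZigZag (ha : 0 < a) (hcont : Continuous lam) (hnonneg : ∀ x, 0 ≤ lam x)
    (hlam : RateAssumption lam) (x : State) :
    ∃ (Ω : Type) (_ : MeasurableSpace Ω) (Q : Measure Ω) (Z : ℕ → Ω → ℝ),
      IsProbabilityMeasure Q ∧ IsZigZag a lam x Q Z := by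
  have := isMarkovKernel_stepKernel ha hcont hnonneg hlam x
  obtain ⟨Q, hQ⟩ : ∃ Q : Measure (ℕ → ℝ),
      Q = Kernel.traj (stepKernel a lam x) 0 fun _ => (0 : ℝ) := ⟨_, rfl⟩
  have hQp : IsProbabilityMeasure Q := by rw [hQ]; infer_instance
  -- Coordinate `0` is the dummy initial value of the trajectory, hence the shift.
  set Z : ℕ → (ℕ → ℝ) → ℝ := fun i ω => ω (i + 1)
  have hZm : ∀ i, Measurable (Z i) := fun i => measurable_pi_apply (i + 1)
  refine ⟨ℕ → ℝ, inferInstance, Q, Z, hQp, hZm, fun i t ht => ?_⟩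
  have hle : history Z i ≤ (Filtration.piLE (X := fun _ : ℕ => ℝ) i : MeasurableSpace _) := by
    have : Measurable[Filtration.piLE (X := fun _ : ℕ => ℝ) i]
        (fun ω (k : Fin i) => Z k ω) := by
      refine @measurable_pi_lambda _ _ _ (_) _ _ fun k => ?_
      exact (measurable_pi_apply (⟨k + 1, k.2⟩ : Set.Iic i)).comp
        (comap_measurable (Preorder.restrictLe i))
    exact this.comap_le
  have h1 := condExp_traj_stepKernel ha hcont hnonneg hlam x i ht hQ
  have hsm : StronglyMeasurable[history Z i]
      fun ω => survival a lam (skeleton a x (fun k => Z k ω) i) t := by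
    refine @Measurable.stronglyMeasurable _ _ (_) _ _ _ _ _ _ ?_
    exact (continuous_survival hcont).measurable.comp
      (@Measurable.prodMk _ _ _ _ _ (_) _ _
        (@measurable_skeleton a _ (history Z i) Z x i fun k hk => measurable_history Z hk)
        (@measurable_const _ _ _ (_) t))
  have hsint : Integrable (fun ω => survival a lam (skeleton a x (fun k => Z k ω) i) t) Q :=
    integrable_condExp.congr h1
  have hpi := (Filtration.piLE (X := fun _ : ℕ => ℝ)).le i
  -- The trajectory filtration also contains the dummy coordinate. The tower property passes to the
  -- smaller `history Z i`, for which the survival term is already measurable.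
  refine (condExp_condExp_of_le hle hpi).symm.trans ((condExp_congr_ae h1).trans ?_)
  exact (condExp_of_stronglyMeasurable (hle.trans hpi) hsm hsint).eventuallyEq

/-! ### The transition function -/

lemma IsZigZag.map_path_apply {Ω : Type*} [MeasurableSpace Ω]
    {Q : Measure Ω} [IsProbabilityMeasure Q] {Z : ℕ → Ω → ℝ} {x : State}
    (ha : 0 < a) (hcont : Continuous lam) (hnonneg : ∀ x, 0 ≤ lam x) (hlam : RateAssumption lam)
    (hZ : IsZigZag a lam x Q Z) {t : ℝ} (ht : 0 ≤ t) {B : Set State} (hB : MeasurableSet B) :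
    Q.map (fun ω => path a x (fun k => Z k ω) t) B
      = ∑' n, switchExp a lam n (B.indicator fun _ => 1) t x := by
  have hp := hZ.aemeasurable_path ha hcont hnonneg hlam ht
  have hf : Measurable (B.indicator fun _ => (1 : ℝ≥0∞)) := measurable_const.indicator hB
  rw [← hZ.lintegral_path ha hcont hnonneg hlam hf ht, ← lintegral_map' hf.aemeasurable hp,
    lintegral_indicator_const hB, one_mul]

/-- The transition function exists, and is a sum over the number of switches. -/
lemma exists_isTransitionFunction (ha : 0 < a) (hcont : Continuous lam)
    (hnonneg : ∀ x, 0 ≤ lam x) (hlam : RateAssumption lam) :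
    ∃ P : ℝ≥0 → Kernel State State, IsTransitionFunction.{u} a lam P ∧
      ∀ (t : ℝ≥0) (x : State) (B : Set State), MeasurableSet B →
        P t x B = ∑' n, switchExp a lam n (B.indicator fun _ => 1) t x := by
  -- The realisations are chosen separately for each starting point; measurability in `x` comes from
  -- the series, not from the choice.
  choose Ω mΩ Q Z hQ hZ using exists_isZigZag ha hcont hnonneg hlam
  have hlaw : ∀ (t : ℝ≥0) (x : State) (B : Set State), MeasurableSet B →
      (Q x).map (fun ω => path a x (fun k => Z x k ω) t) B
        = ∑' n, switchExp a lam n (B.indicator fun _ => 1) t x :=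
    fun t x B hB => (hZ x).map_path_apply ha hcont hnonneg hlam t.coe_nonneg hB
  have hmeas : ∀ t : ℝ≥0, Measurable fun x =>
      (Q x).map (fun ω => path a x (fun k => Z x k ω) t) := by
    intro t
    refine Measure.measurable_of_measurable_coe _ fun B hB => ?_
    simp only [hlaw t _ B hB]
    exact Measurable.tsum fun n =>
      (measurable_switchExp hcont n (measurable_const.indicator hB)).comp measurable_prodMk_left
  refine ⟨fun t => ⟨_, hmeas t⟩, ⟨fun t => ⟨fun x => ?_⟩,
    fun x => ⟨Ω x, mΩ x, Q x, Z x, hQ x, hZ x⟩,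
    fun x Ω' _ Q' _ Z' hZ' => hZ'.tendsto_switchTime ha hcont hnonneg hlam,
    fun x Ω' _ Q' _ Z' hZ' t => Measure.ext fun B hB => ?_⟩, hlaw⟩
  · exact Measure.isProbabilityMeasure_map
      ((hZ x).aemeasurable_path ha hcont hnonneg hlam t.coe_nonneg)
  · exact (hZ'.map_path_apply ha hcont hnonneg hlam t.coe_nonneg hB).trans (hlaw t x B hB).symm

/-- A kernel that is the sum over the number of switches leaves the measure with density
`exp (-Ψ)` invariant. -/
lemma invariant_of_eq_tsum_switchExp (ha : 0 < a) (hcont : Continuous lam)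
    (hnonneg : ∀ x, 0 ≤ lam x) {κ : Kernel State State} [IsMarkovKernel κ] {t : ℝ}
    (hκ : ∀ (x : State) (B : Set State), MeasurableSet B →
      κ x B = ∑' n, switchExp a lam n (B.indicator fun _ => 1) t x) :
    κ.Invariant (invMeasure a lam) := by
  have hm : ∀ (n : ℕ) {f : State → ℝ≥0∞}, Measurable f →
      Measurable fun x => switchExp a lam n f t x :=
    fun n f hf => (measurable_switchExp hcont n hf).comp measurable_prodMk_left
  refine Measure.ext fun B hB => ?_
  have hf : Measurable (B.indicator fun _ => (1 : ℝ≥0∞)) := measurable_const.indicator hB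
  rw [Measure.bind_apply hB κ.measurable.aemeasurable]
  simp only [hκ _ B hB]
  rw [lintegral_tsum fun n => (hm n hf).aemeasurable]
  have h1 : ∀ n, ∫⁻ x, switchExp a lam n (B.indicator fun _ => 1) t x ∂(invMeasure a lam)
      = ∫⁻ x, switchExp a lam n (fun _ => 1) t (x.1, -x.2) * B.indicator (fun _ => 1) x
          ∂(invMeasure a lam) := fun n => by
    simpa using lintegral_mul_switchExp ha hcont hnonneg n hf (g := fun _ => 1)
      measurable_const t
  -- The total mass of the Markov kernel `κ` is one.
  have h2 : ∀ x, ∑' n, switchExp a lam n (fun _ => 1) t x = 1 := fun x => by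
    simpa using (hκ x Set.univ .univ).symm
  simp only [h1]
  rw [← lintegral_tsum (f := fun n (x : State) => switchExp a lam n (fun _ => 1) t (x.1, -x.2) *
    B.indicator (fun _ => 1) x) fun n => (((hm n measurable_const).comp measurable_flip).fun_mul
    hf).aemeasurable]
  simp only [ENNReal.tsum_mul_right, h2, one_mul]
  rw [lintegral_indicator_const hB, one_mul]

end

end ZigZag

theorem mainTheorem6 (a : ℝ) (ha : 0 < a) (lam : ZigZag.State → ℝ)
    (hcont : Continuous lam) (hnonneg : ∀ x, 0 ≤ lam x)
    (hlam : ZigZag.RateAssumption lam) :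
    (∀ y : ℝ, IntervalIntegrable (fun η : ℝ => lam (η, 1) - lam (η, -1)) volume 0 y) ∧
    BddBelow (Set.range (ZigZag.potential a lam)) ∧
    ∃ P : ℝ≥0 → Kernel ZigZag.State ZigZag.State,
      ZigZag.IsTransitionFunction.{u} a lam P ∧
      ∀ t : ℝ≥0, (P t).Invariant (ZigZag.invMeasure a lam) := by
  refine ⟨fun y => (ZigZag.continuous_rate_diff hcont).intervalIntegrable _ _,
    ZigZag.bddBelow_range_potential ha hcont hlam, ?_⟩
  obtain ⟨P, hP, hPt⟩ := ZigZag.exists_isTransitionFunction.{u} ha hcont hnonneg hlam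
  refine ⟨P, hP, fun t => ?_⟩
  have := hP.markov t
  exact ZigZag.invariant_of_eq_tsum_switchExp ha hcont hnonneg (hPt t)
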